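/- For a bipartite pure state (unit vector) $\psi\in\mathbb{C}^{d}\otimes\mathbb{C}^{d'}$ let $C(\psi)=\sqrt{2(1-\mathrm{Tr}\,\rho_r^2)}$, where $\rho_r$ is the partial trace of $|\psi\rangle\langle\psi|$ over one of the two shares, and for a bipartite mixed state $\rho$ let $C(\rho)=\inf\sum_i p_i\,C(\psi_i)$, the infimum over all finite decompositions $\rho=\sum_i p_i|\psi_i\rangle\langle\psi_i|$ into pure states $\psi_i$ with probabilities $p_i$ (the concurrence). Let $N\ge 1$ and let $\rho_{01},\rho_{12},\dots,\rho_{N-1,N}$ be two-qubit density matrices, the state $\rho_{k-1,k}$ being shared between party $k-1$ and party $k$ (one qubit each), for $k=1,\dots,N$. Suppose that the $N+1$ parties $0,1,\dots,N$ perform an arbitrary LOCC protocol on the initial state $\rho_{01}\otimes\rho_{12}\otimes\cdots\otimes\rho_{N-1,N}$: a finite number of rounds in which each party applies to its own share a local instrument with finitely many outcomes (which may change the dimension of the share, and may depend on all outcomes of earlier rounds) and broadcasts its outcome to all parties; at the end of each branch of the protocol a final outcome $j$ from a finite set is declared, and different branches may end in the same final outcome provided that the parties then hold systems of the same kind. Let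 $P_j$ be the probability of the final outcome $j$, and let $\sigma^{j}_{0N}$ be the resulting state of parties $0$ and $N$, that is, the normalized final joint state on outcome $j$ traced over the shares of all other parties. Then $$\sum_j P_j\,C(\sigma^{j}_{0N})\;\le\;C(\rho_{01})\,C(\rho_{12})\cdots C(\rho_{N-1,N}),$$ where terms with $P_j=0$ count as $0$. -/

import Mathlib

open scoped ComplexOrder Matrix

noncomputable section

namespace QNet

/-! ### Density matrices and concurrence -/

/-- A density matrix on `ℂ^ι`: positive semidefinite of trace one. -/
def IsDensity {ι : Type*} [Fintype ι] (ρ : Matrix ι ι ℂ) : Prop :=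
  ρ.PosSemidef ∧ ρ.trace = 1

/-- A unit vector of `ℂ^ι`. -/
def IsUnitVec {ι : Type*} [Fintype ι] (ψ : ι → ℂ) : Prop :=
  ∑ i, ‖ψ i‖ ^ 2 = 1

/-- The rank-one matrix `|ψ⟩⟨ψ|`. -/
def ketbra {ι : Type*} (ψ : ι → ℂ) : Matrix ι ι ℂ :=
  Matrix.vecMulVec ψ (star ψ)

/-- Partial trace of a bipartite matrix over the second share. -/
def traceSnd {α β : Type*} [Fintype β] (ρ : Matrix (α × β) (α × β) ℂ) : Matrix α α ℂ :=
  Matrix.of fun a a' => ∑ b, ρ (a, b) (a', b)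

/-- Concurrence of a bipartite pure state, `√(2 (1 - Tr ρ_r²))`, where `ρ_r` is the reduced state. -/
def pureConcurrence {α β : Type*} [Fintype α] [Fintype β] (ψ : α × β → ℂ) : ℝ :=
  √(2 * (1 - ((traceSnd (ketbra ψ) * traceSnd (ketbra ψ)).trace).re))

/-- `p`, `ψ` is a decomposition of `ρ` as a mixture of pure states:
`ρ = ∑ i, p i |ψ i⟩⟨ψ i|`, with probabilities `p i` and unit vectors `ψ i`. -/
def IsDecomposition {ι : Type*} [Fintype ι] (ρ : Matrix ι ι ℂ) {n : ℕ}
    (p : Fin n → ℝ) (ψ : Fin n → ι → ℂ) : Prop :=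
  (∀ i, 0 ≤ p i) ∧ ∑ i, p i = 1 ∧ (∀ i, IsUnitVec (ψ i)) ∧
    ρ = ∑ i, (p i : ℂ) • ketbra (ψ i)

/-- Concurrence of a bipartite mixed state (convex roof): the least average concurrence over all
decompositions of the state into pure states. -/
def concurrence {α β : Type*} [Fintype α] [Fintype β] (ρ : Matrix (α × β) (α × β) ℂ) : ℝ :=
  sInf {c : ℝ | ∃ (n : ℕ) (p : Fin n → ℝ) (ψ : Fin n → α × β → ℂ),
    IsDecomposition ρ p ψ ∧ c = ∑ i, p i * pureConcurrence (ψ i)}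

/-! ### Multipartite systems and LOCC -/

/-- A finite-dimensional quantum system `ℂ^basis`, given by the label set of its standard basis. -/
structure System where
  basis : Type
  [fintype : Fintype basis]
  [decEq : DecidableEq basis]

instance : CoeSort System Type := ⟨System.basis⟩
instance (A : System) : Fintype A := A.fintype
instance (A : System) : DecidableEq A := A.decEq

/-- The standard basis labels of the joint system of parties `p : P` that hold systems `d p`. -/
abbrev Joint {P : Type} (d : P → System) : Type := ∀ p, d p

/-- Matrices (operators) on the joint system of all parties. -/
abbrev Op {P : Type} (d : P → System) : Type := Matrix (Joint d) (Joint d) ℂ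

/-- A quantum instrument on the system `A`: the most general measurement with finitely many
outcomes. On outcome `o` the system `A` is turned into the system `out o`, and the state `ρ` into
the unnormalized state `∑ l, K_l ρ K_lᴴ`, where `K_l = kraus o l`. -/
structure Instrument (A : System) where
  Outcome : Type
  [fintypeOutcome : Fintype Outcome]
  out : Outcome → System
  Label : Outcome → Type
  [fintypeLabel : ∀ o, Fintype (Label o)]
  kraus : ∀ o, Label o → Matrix (out o) A ℂ
  complete : ∑ o, ∑ l, (kraus o l)ᴴ * kraus o l = 1

instance {A : System} (I : Instrument A) : Fintype I.Outcome := I.fintypeOutcome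
instance {A : System} (I : Instrument A) (o : I.Outcome) : Fintype (I.Label o) := I.fintypeLabel o

section

variable {P : Type} [Fintype P] [DecidableEq P]

/-- The tensor product `⨂ p, K p` of local operators. -/
def tensorOp {d e : P → System} (K : ∀ p, Matrix (e p) (d p) ℂ) : Matrix (Joint e) (Joint d) ℂ :=
  Matrix.of fun x y => ∏ p, K p (x p) (y p)

/-- The unnormalized joint state after each party `p` has applied the instrument `I p` to its own
share of `ρ`, with outcomes `o p`. -/
def applyLocal {d : P → System} (I : ∀ p, Instrument (d p)) (o : ∀ p, (I p).Outcome) (ρ : Op d) :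
    Op (fun p => (I p).out (o p)) :=
  ∑ l : ∀ p, (I p).Label (o p),
    tensorOp (fun p => (I p).kraus (o p) (l p)) * ρ * (tensorOp fun p => (I p).kraus (o p) (l p))ᴴ

/-- LOCC protocols of the parties `P` that start on the systems `d` and have final outcomes in `J`;
when the final outcome is `j`, the parties hold the systems `out j`.
Either the parties finish, with final outcome `j`, or they carry out one more round: each party
applies an instrument to its share (possibly the trivial one) and broadcasts the outcome; the
protocol `next o` that they carry out afterwards depends on all outcomes `o` of the round.
Several branches of a protocol may end in the same final outcome (classical information may be
forgotten). -/
inductive LOCC {J : Type} (out : J → P → System) : (P → System) → Type 1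
  | finish (j : J) : LOCC out (out j)
  | round {d : P → System} (I : ∀ p, Instrument (d p))
      (next : ∀ o : (∀ p, (I p).Outcome), LOCC out (fun p => (I p).out (o p))) : LOCC out d

/-- The unnormalized final joint state of an LOCC protocol with initial state `ρ` on the final
outcome `j`: the sum over all branches of the protocol that end in `j`. -/
def LOCC.final {J : Type} [DecidableEq J] {out : J → P → System} :
    {d : P → System} → LOCC out d → Op d → (j : J) → Op (out j)
  | _, .finish j, ρ => Pi.single j ρ
  | _, .round I next, ρ => fun j => ∑ o, (next o).final (applyLocal I o ρ) j

/-- The probability of the final outcome `j`. -/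
def LOCC.prob {J : Type} [DecidableEq J] {out : J → P → System} {d : P → System}
    (Λ : LOCC out d) (ρ : Op d) (j : J) : ℝ :=
  (Λ.final ρ j).trace.re

/-- The normalized final joint state on the final outcome `j` (if that has nonzero probability). -/
def LOCC.state {J : Type} [DecidableEq J] {out : J → P → System} {d : P → System}
    (Λ : LOCC out d) (ρ : Op d) (j : J) : Op (out j) :=
  ((Λ.prob ρ j)⁻¹ : ℂ) • Λ.final ρ j

/-- The reduced operator on the shares of two (distinct) parties `a` and `b`: the partial trace
over the shares of all other parties. -/
def reduce {d : P → System} (a b : P) (ρ : Op d) : Matrix (d a × d b) (d a × d b) ℂ :=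
  Matrix.of fun u v => ∑ x : Joint d, ∑ y : Joint d,
    if x a = u.1 ∧ x b = u.2 ∧ y a = v.1 ∧ y b = v.2 ∧ (∀ p, p ≠ a → p ≠ b → x p = y p)
    then ρ x y else 0

end

/-! ### The aligned chain of two-qubit states -/

/-- The `k`-th pair of the chain (`k = 0, …, N - 1`) consists of the qubits `(k, 0)` and `(k, 1)`;
they are held by the parties `k` and `k + 1`, out of the parties `0, …, N`. -/
def owner {N : ℕ} (q : Fin N × Fin 2) : Fin (N + 1) :=
  if q.2 = 0 then q.1.castSucc else q.1.succ

/-- The initial share of party `p`: all the qubits that it holds. -/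
def chainSystem (N : ℕ) (p : Fin (N + 1)) : System where
  basis := {q : Fin N × Fin 2 // owner q = p} → Fin 2

/-- The basis value of the qubit `q` in a basis label of the joint system of the chain. -/
def qubit {N : ℕ} (x : Joint (chainSystem N)) (q : Fin N × Fin 2) : Fin 2 :=
  x (owner q) ⟨q, rfl⟩

/-- The initial state of the chain, the tensor product of the `N` two-qubit states `ρ k`. -/
def chainState {N : ℕ} (ρ : Fin N → Matrix (Fin 2 × Fin 2) (Fin 2 × Fin 2) ℂ) :
    Op (chainSystem N) :=
  Matrix.of fun x y => ∏ k, ρ k (qubit x (k, 0), qubit x (k, 1)) (qubit y (k, 0), qubit y (k, 1))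

end QNet

end

/-!
The concurrence of an unnormalized bipartite vector, regarded as a matrix `M`, is the Euclidean norm
of the family of `2 × 2` minors of `M` (`minorNorm`, `sum_minor_sq`). For mixed states it suffices
to exhibit decompositions into unnormalized vectors, since `P * concurrence (P⁻¹ • σ)` is at most
the sum of `minorNorm` over any of them (`HasRoof.mul_concurrence_le`).

Only two properties of LOCC protocols matter: the final state is a sum over branches `b`, each of
which acts by a product operator `⨂ p, K b p`, and these operators satisfy the completeness relation
(`LOCC.exists_branches`). Taking the trace of that relation, the weights `∏ p, ‖K b p‖²`
(Hilbert–Schmidt norms) add up to the dimension `4 ^ N` of the chain (`sum_prod_hsSq`).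

Let the initial states be pure, with `2 × 2` coefficient matrices `U k`. In a branch, with the inner
parties projected to basis states, the vector left to the two end parties has the matrix `A T Bᵀ`,
where `A` and `B` are the operators of the end parties (two columns each) and `T` is the product of
the `U k` interlaced with the `2 × 2` matrices of the inner parties (`exists_factor_slice`). By
multiplicativity of minors its concurrence is a product of `|det T|` with the minors of `A` and `B`.
Each determinant or minor is at most half of a squared Hilbert–Schmidt norm, by the
arithmetic-geometric mean inequality, and the concurrence of the `k`-th pair is `2 |det (U k)|`. So
the branch contributes at most the product of the initial concurrences times
`4 ^ (-N) * ∏ p, ‖K b p‖²` (`hasRoof_branch`), and these factors add up to one over all branches.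
Decompositions of the initial mixed states and their infimum give the general case.
-/

open scoped ComplexOrder Matrix

namespace QNet

/-! ### Convex roofs of the concurrence -/

/-- The concurrence of a not necessarily normalized vector of `ℂ^α ⊗ ℂ^β`, regarded as an
`α × β` matrix: the Euclidean norm of its family of `2 × 2` minors, where the minors are indexed by
ordered pairs of rows and ordered pairs of columns. It is homogeneous of degree two. -/
noncomputable def minorNorm {α β : Type*} [Fintype α] [Fintype β] (v : α × β → ℂ) : ℝ :=
  √(∑ a, ∑ a', ∑ b, ∑ b', ‖v (a, b) * v (a', b') - v (a, b') * v (a', b)‖ ^ 2)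

section

variable {α β : Type*} [Fintype α] [Fintype β]

theorem minorNorm_nonneg (v : α × β → ℂ) : 0 ≤ minorNorm v := Real.sqrt_nonneg _

theorem minorNorm_smul (c : ℂ) (v : α × β → ℂ) : minorNorm (c • v) = ‖c‖ ^ 2 * minorNorm v := by
  unfold minorNorm
  rw [← Real.sqrt_sq (by positivity : 0 ≤ ‖c‖ ^ 2), ← Real.sqrt_mul (by positivity)]
  simp only [Finset.mul_sum, Pi.smul_apply, smul_eq_mul]
  congr 1
  refine Finset.sum_congr rfl fun a _ => Finset.sum_congr rfl fun a' _ =>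
    Finset.sum_congr rfl fun b _ => Finset.sum_congr rfl fun b' _ => ?_
  rw [show c * v (a, b) * (c * v (a', b')) - c * v (a, b') * (c * v (a', b))
    = c ^ 2 * (v (a, b) * v (a', b') - v (a, b') * v (a', b)) by ring, norm_mul, norm_pow]
  ring

theorem ketbra_smul {ι : Type*} (c : ℂ) (v : ι → ℂ) :
    ketbra (c • v) = ((‖c‖ ^ 2 : ℝ) : ℂ) • ketbra v := by
  ext i j
  have h : c * star c = ((‖c‖ ^ 2 : ℝ) : ℂ) := by
    rw [Complex.star_def, Complex.mul_conj, Complex.normSq_eq_norm_sq]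
  simp only [ketbra, Matrix.vecMulVec_apply, Pi.smul_apply, Pi.star_apply, Matrix.smul_apply,
    smul_eq_mul, ← h, star_mul']
  ring

theorem trace_ketbra {ι : Type*} [Fintype ι] (v : ι → ℂ) :
    (ketbra v).trace = ((∑ i, ‖v i‖ ^ 2 : ℝ) : ℂ) := by
  simp only [Matrix.trace, Matrix.diag, ketbra, Matrix.vecMulVec_apply, Pi.star_apply,
    Complex.star_def, Complex.mul_conj, Complex.normSq_eq_norm_sq, Complex.ofReal_sum]

theorem mul_ketbra_mul {ι κ : Type*} [Fintype ι] [Fintype κ] (K : Matrix κ ι ℂ) (v : ι → ℂ) :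
    K * ketbra v * Kᴴ = ketbra (K *ᵥ v) := by
  rw [ketbra, ketbra, Matrix.mul_vecMulVec, Matrix.vecMulVec_mul, Matrix.star_mulVec]

theorem norm_sub_sq_complex (z w : ℂ) :
    ‖z - w‖ ^ 2 = ‖z‖ ^ 2 + ‖w‖ ^ 2 - 2 * (z * star w).re := by
  simp only [← Complex.normSq_eq_norm_sq, Complex.normSq_sub, Complex.star_def]

/-- Lagrange's identity for the `2 × 2` minors of a matrix. -/
theorem sum_minor_sq (v : α × β → ℂ) :
    ∑ a, ∑ a', ∑ b, ∑ b', ‖v (a, b) * v (a', b') - v (a, b') * v (a', b)‖ ^ 2 =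
      2 * ((∑ x, ‖v x‖ ^ 2) ^ 2 - ((traceSnd (ketbra v) * traceSnd (ketbra v)).trace).re) := by
  have h1 : (∑ x, ‖v x‖ ^ 2) ^ 2 =
      ∑ a, ∑ a', ∑ b, ∑ b', ‖v (a, b) * v (a', b')‖ ^ 2 := by
    rw [sq, Fintype.sum_prod_type, Finset.sum_mul_sum]
    simp only [Finset.sum_mul_sum, norm_mul, mul_pow]
  have h2 : (∑ x, ‖v x‖ ^ 2) ^ 2 =
      ∑ a, ∑ a', ∑ b, ∑ b', ‖v (a, b') * v (a', b)‖ ^ 2 := by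
    rw [h1]
    exact Finset.sum_congr rfl fun a _ => Finset.sum_congr rfl fun a' _ => Finset.sum_comm
  have h3 : ((traceSnd (ketbra v) * traceSnd (ketbra v)).trace).re =
      ∑ a, ∑ a', ∑ b, ∑ b', ((v (a, b) * v (a', b')) * star (v (a, b') * v (a', b))).re := by
    simp only [Matrix.trace, Matrix.diag, Matrix.mul_apply, traceSnd, ketbra, Matrix.of_apply,
      Matrix.vecMulVec_apply, Pi.star_apply, Finset.sum_mul_sum, Complex.re_sum, star_mul']
    refine Finset.sum_congr rfl fun a _ => Finset.sum_congr rfl fun a' _ =>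
      Finset.sum_congr rfl fun b _ => Finset.sum_congr rfl fun b' _ => ?_
    congr 1
    ring
  simp only [norm_sub_sq_complex, Finset.sum_sub_distrib, Finset.sum_add_distrib, ← Finset.mul_sum]
  rw [← h1, ← h2, ← h3]
  ring

theorem pureConcurrence_eq_minorNorm {ψ : α × β → ℂ} (hψ : IsUnitVec ψ) :
    pureConcurrence ψ = minorNorm ψ := by
  rw [pureConcurrence, minorNorm, sum_minor_sq, hψ, one_pow]

/-- Every density matrix is a mixture of pure states, namely of its eigenvectors. -/
theorem IsDensity.exists_isDecomposition {ι : Type*} [Fintype ι] [DecidableEq ι] {ρ : Matrix ι ι ℂ}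
    (h : IsDensity ρ) :
    ∃ (n : ℕ) (p : Fin n → ℝ) (ψ : Fin n → ι → ℂ), IsDecomposition ρ p ψ := by
  obtain ⟨hp, ht⟩ := h
  have hH := hp.isHermitian
  let f := (Fintype.equivFin ι).symm
  refine ⟨Fintype.card ι, fun i => hH.eigenvalues (f i), fun i => hH.eigenvectorBasis (f i),
    fun i => hp.eigenvalues_nonneg _, ?_, fun i => ?_, ?_⟩
  · rw [f.sum_comp fun i => hH.eigenvalues i]
    have := hH.trace_eq_sum_eigenvalues
    rw [ht] at this
    simpa using (congrArg Complex.re this).symm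
  · have := hH.eigenvectorBasis.orthonormal.1 (f i)
    rw [EuclideanSpace.norm_eq, Real.sqrt_eq_one] at this
    exact this
  · rw [f.sum_comp fun i => (hH.eigenvalues i : ℂ) • ketbra (hH.eigenvectorBasis i : ι → ℂ)]
    conv_lhs => rw [hH.spectral_theorem]
    ext i j
    simp [Unitary.conjStarAlgAut_apply, Matrix.mul_apply, Matrix.diagonal_apply, ketbra,
      Matrix.sum_apply, Matrix.vecMulVec_apply, Matrix.IsHermitian.eigenvectorUnitary_apply]
    refine Finset.sum_congr rfl fun k _ => by ring

end

/-- `c` bounds the convex roof of `minorNorm` at `σ`: the matrix `σ` is a finite sum of matrices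
`|v⟩⟨v|`, with unnormalized `v`, whose values of `minorNorm` add up to at most `c`. -/
def HasRoof {α β : Type*} [Fintype α] [Fintype β] (σ : Matrix (α × β) (α × β) ℂ) (c : ℝ) : Prop :=
  ∃ (ι : Type) (_ : Fintype ι) (v : ι → α × β → ℂ),
    σ = ∑ i, ketbra (v i) ∧ ∑ i, minorNorm (v i) ≤ c

section

variable {α β : Type*} [Fintype α] [Fintype β]

theorem HasRoof.ketbra (v : α × β → ℂ) : HasRoof (ketbra v) (minorNorm v) :=
  ⟨Unit, inferInstance, fun _ => v, by simp, by simp⟩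

theorem HasRoof.zero : HasRoof (0 : Matrix (α × β) (α × β) ℂ) 0 :=
  ⟨Empty, inferInstance, fun i => i.elim, by simp, by simp⟩

theorem HasRoof.mono {σ : Matrix (α × β) (α × β) ℂ} {c c' : ℝ} (h : HasRoof σ c) (hc : c ≤ c') :
    HasRoof σ c' := by
  obtain ⟨ι, _, v, h1, h2⟩ := h
  exact ⟨ι, _, v, h1, h2.trans hc⟩

theorem HasRoof.sum {κ : Type} [Fintype κ] {σ : κ → Matrix (α × β) (α × β) ℂ} {c : κ → ℝ}
    (h : ∀ k, HasRoof (σ k) (c k)) : HasRoof (∑ k, σ k) (∑ k, c k) := by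
  choose ι hι v h1 h2 using h
  refine ⟨Σ k, ι k, inferInstance, fun x => v x.1 x.2, ?_, ?_⟩
  · rw [Fintype.sum_sigma]
    exact Finset.sum_congr rfl fun k _ => h1 k
  · rw [Fintype.sum_sigma]
    exact Finset.sum_le_sum fun k _ => h2 k

/-- The concurrence of the normalization of a positive matrix, times its trace, is at most any
bound of the convex roof at that matrix. -/
theorem HasRoof.mul_concurrence_le {σ : Matrix (α × β) (α × β) ℂ} {c : ℝ} (h : HasRoof σ c) :
    σ.trace.re * concurrence ((σ.trace.re : ℂ)⁻¹ • σ) ≤ c := by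
  classical
  obtain ⟨ι, _, v, h1, h2⟩ := h
  set P := σ.trace.re with hP
  have hPsum : P = ∑ i, ∑ x, ‖v i x‖ ^ 2 := by
    rw [hP, h1, Matrix.trace_sum]
    simp only [trace_ketbra, Complex.re_sum, Complex.ofReal_re]
  have hP0 : 0 ≤ P := by rw [hPsum]; positivity
  rcases hP0.eq_or_lt with h0 | hpos
  · rw [← h0, zero_mul]
    exact (Finset.sum_nonneg fun i _ => minorNorm_nonneg _).trans h2
  have : Nonempty (α × β) := by
    by_contra hne
    rw [not_nonempty_iff] at hne
    simp [hPsum] at hpos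
  obtain ⟨x₀⟩ := this
  let s : ι → ℝ := fun i => ∑ x, ‖v i x‖ ^ 2
  have hs0 : ∀ i, 0 ≤ s i := fun i => by positivity
  -- each `v i` is a multiple of a unit vector, which is arbitrary when `v i = 0`
  have key : ∀ i, ∃ ψ : α × β → ℂ, IsUnitVec ψ ∧ v i = ((√(s i) : ℝ) : ℂ) • ψ := by
    intro i
    rcases (hs0 i).eq_or_lt with hz | hz
    · refine ⟨Pi.single x₀ 1, ?_, ?_⟩
      · rw [IsUnitVec, Finset.sum_eq_single x₀] <;> simp +contextual
      · rw [← hz]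
        funext x
        have := (Finset.sum_eq_zero_iff_of_nonneg (fun x _ => by positivity)).1 hz.symm x
          (Finset.mem_univ x)
        simpa using this
    · have hq : √(s i) ≠ 0 := (Real.sqrt_pos.2 hz).ne'
      refine ⟨((√(s i) : ℝ) : ℂ)⁻¹ • v i, ?_, ?_⟩
      · simp only [IsUnitVec, Pi.smul_apply, smul_eq_mul, norm_mul, norm_inv, mul_pow,
          Complex.norm_real, Real.norm_eq_abs, ← Finset.mul_sum, inv_pow, sq_abs,
          Real.sq_sqrt (hs0 i)]
        exact inv_mul_cancel₀ hz.ne'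
      · rw [smul_smul, mul_inv_cancel₀ (by exact_mod_cast hq), one_smul]
  choose ψ hψ hv using key
  have hn : ∀ i, ‖((√(s i) : ℝ) : ℂ)‖ ^ 2 = s i := fun i => by
    rw [Complex.norm_real, Real.norm_eq_abs, sq_abs, Real.sq_sqrt (hs0 i)]
  have hC : concurrence ((P : ℂ)⁻¹ • σ) ≤ ∑ i, s i / P * pureConcurrence (ψ i) := by
    let f := (Fintype.equivFin ι).symm
    refine csInf_le ⟨0, ?_⟩ ⟨Fintype.card ι, fun k => s (f k) / P, fun k => ψ (f k),
      ⟨fun k => div_nonneg (hs0 _) hP0, ?_, fun k => hψ _, ?_⟩, ?_⟩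
    · rintro _ ⟨n, p, ψ, h, rfl⟩
      exact Finset.sum_nonneg fun i _ => mul_nonneg (h.1 i) (Real.sqrt_nonneg _)
    · rw [f.sum_comp fun i => s i / P, ← Finset.sum_div, ← hPsum, div_self hpos.ne']
    · rw [f.sum_comp fun i => ((s i / P : ℝ) : ℂ) • QNet.ketbra (ψ i), h1, Finset.smul_sum]
      refine Finset.sum_congr rfl fun i _ => ?_
      conv_lhs => rw [hv i, ketbra_smul, hn, smul_smul]
      congr 1
      push_cast
      ring
    · rw [f.sum_comp fun i => s i / P * pureConcurrence (ψ i)]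
  calc P * concurrence ((P : ℂ)⁻¹ • σ)
      ≤ P * ∑ i, s i / P * pureConcurrence (ψ i) := by gcongr
    _ = ∑ i, minorNorm (v i) := by
      rw [Finset.mul_sum]
      refine Finset.sum_congr rfl fun i _ => ?_
      conv_rhs => rw [hv i, minorNorm_smul, hn, ← pureConcurrence_eq_minorNorm (hψ i)]
      field_simp
    _ ≤ c := h2

/-- A density matrix has bounds of its convex roof that are arbitrarily close to its concurrence. -/
theorem IsDensity.exists_roof [DecidableEq α] [DecidableEq β] {ρ : Matrix (α × β) (α × β) ℂ}
    (h : IsDensity ρ) {ε : ℝ} (hε : 0 < ε) : HasRoof ρ (concurrence ρ + ε) := by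
  obtain ⟨n, p, ψ, hd⟩ := h.exists_isDecomposition
  obtain ⟨_, ⟨n, p, ψ, hd, rfl⟩, hlt⟩ := exists_lt_of_csInf_lt
    (s := {c : ℝ | ∃ (n : ℕ) (p : Fin n → ℝ) (ψ : Fin n → α × β → ℂ),
      IsDecomposition ρ p ψ ∧ c = ∑ i, p i * pureConcurrence (ψ i)}) ⟨_, n, p, ψ, hd, rfl⟩
    (show concurrence ρ < concurrence ρ + ε from lt_add_of_pos_right _ hε)
  have hn : ∀ i, ‖((√(p i) : ℝ) : ℂ)‖ ^ 2 = p i := fun i => by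
    rw [Complex.norm_real, Real.norm_eq_abs, sq_abs, Real.sq_sqrt (hd.1 i)]
  refine ⟨Fin n, inferInstance, fun i => ((√(p i) : ℝ) : ℂ) • ψ i, ?_, ?_⟩
  · simp only [ketbra_smul, hn]
    exact hd.2.2.2
  · refine le_trans (le_of_eq (Finset.sum_congr rfl fun i _ => ?_)) hlt.le
    rw [minorNorm_smul, hn, pureConcurrence_eq_minorNorm (hd.2.2.1 i)]

end

/-! ### LOCC protocols as separable operations -/

section

variable {P : Type} [Fintype P]

theorem tensorOp_one (d : P → System) :
    tensorOp (fun p => (1 : Matrix (d p) (d p) ℂ)) = 1 := by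
  ext x y
  simp only [tensorOp, Matrix.of_apply, Matrix.one_apply, Finset.prod_ite_zero,
    Finset.prod_const_one, Finset.mem_univ, true_implies, funext_iff]

theorem tensorOp_mul [DecidableEq P] {c d e : P → System} (K : ∀ p, Matrix (e p) (d p) ℂ)
    (L : ∀ p, Matrix (d p) (c p) ℂ) :
    tensorOp (fun p => K p * L p) = tensorOp K * tensorOp L := by
  ext x y
  simp only [tensorOp, Matrix.of_apply, Matrix.mul_apply, Finset.prod_univ_sum,
    Fintype.piFinset_univ, Finset.prod_mul_distrib]

theorem tensorOp_conjTranspose {d e : P → System} (K : ∀ p, Matrix (e p) (d p) ℂ) :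
    (tensorOp K)ᴴ = tensorOp fun p => (K p)ᴴ := by
  ext x y
  simp [tensorOp, Matrix.conjTranspose_apply]

theorem sum_tensorOp [DecidableEq P] {κ : P → Type} [∀ p, Fintype (κ p)] {d e : P → System}
    (K : ∀ p, κ p → Matrix (e p) (d p) ℂ) :
    ∑ l : ∀ p, κ p, tensorOp (fun p => K p (l p)) = tensorOp fun p => ∑ l, K p l := by
  ext x y
  simp only [tensorOp, Matrix.of_apply, Matrix.sum_apply, Finset.prod_univ_sum,
    Fintype.piFinset_univ]

/-- The operators of all outcomes of a round of local instruments satisfy the completeness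
relation. -/
theorem sum_round_complete [DecidableEq P] {d : P → System} (I : ∀ p, Instrument (d p)) :
    ∑ o : ∀ p, (I p).Outcome, ∑ l : ∀ p, (I p).Label (o p),
      (tensorOp fun p => (I p).kraus (o p) (l p))ᴴ * tensorOp (fun p => (I p).kraus (o p) (l p))
      = 1 := by
  simp only [tensorOp_conjTranspose, ← tensorOp_mul]
  have h : ∀ o : ∀ p, (I p).Outcome,
      ∑ l : ∀ p, (I p).Label (o p),
        tensorOp (fun p => ((I p).kraus (o p) (l p))ᴴ * (I p).kraus (o p) (l p)) =
      tensorOp fun p => ∑ l, ((I p).kraus (o p) l)ᴴ * (I p).kraus (o p) l := fun o =>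
    sum_tensorOp fun p (l : (I p).Label (o p)) => ((I p).kraus (o p) l)ᴴ * (I p).kraus (o p) l
  simp only [h]
  rw [sum_tensorOp fun p (o : (I p).Outcome) => ∑ l, ((I p).kraus o l)ᴴ * (I p).kraus o l]
  simp only [(I _).complete, tensorOp_one]

/-- An LOCC protocol is a separable operation: its branches, refined by the labels of the Kraus
operators, form a finite type `B`, the branch `b` ends in the outcome `f b` and acts by a product
operator `⨂ p, K b p`, and these product operators satisfy the completeness relation. -/
theorem LOCC.exists_branches [DecidableEq P] {J : Type} [DecidableEq J] {out : J → P → System}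
    {d : P → System}     (Λ : LOCC out d) :
    ∃ (B : Type) (_ : Fintype B) (f : B → J) (K : ∀ b p, Matrix (out (f b) p) (d p) ℂ),
      (∀ ρ : Op d, Λ.final ρ =
        ∑ b, Pi.single (f b) (tensorOp (K b) * ρ * (tensorOp (K b))ᴴ)) ∧
      ∑ b, (tensorOp (K b))ᴴ * tensorOp (K b) = 1 := by
  induction Λ with
  | finish j =>
    refine ⟨Unit, inferInstance, fun _ => j, fun _ _ => 1, fun ρ => ?_, ?_⟩
    · simp [LOCC.final, tensorOp_one]
    · simp [tensorOp_one]
  | @round d I next ih =>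
    choose B hB f K hK h1 using ih
    refine ⟨Σ o : ∀ p, (I p).Outcome, (∀ p, (I p).Label (o p)) × B o, inferInstance,
      fun b => f b.1 b.2.2, fun b p => K b.1 b.2.2 p * (I p).kraus (b.1 p) (b.2.1 p),
      fun ρ => ?_, ?_⟩
    · rw [LOCC.final]
      funext j
      rw [Fintype.sum_sigma, Finset.sum_apply]
      refine Finset.sum_congr rfl fun o _ => ?_
      rw [hK, Finset.sum_apply, Fintype.sum_prod_type_right, Finset.sum_apply]
      refine Finset.sum_congr rfl fun b _ => ?_
      rw [Finset.sum_apply]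
      dsimp only
      by_cases hj : f o b = j
      · subst hj
        simp only [Pi.single_eq_same, applyLocal, tensorOp_mul, Matrix.mul_sum, Matrix.sum_mul,
          Matrix.conjTranspose_mul, Matrix.mul_assoc]
      · simp only [Pi.single_eq_of_ne' hj, Finset.sum_const_zero]
    · rw [Fintype.sum_sigma, ← sum_round_complete I]
      refine Finset.sum_congr rfl fun o _ => ?_
      rw [Fintype.sum_prod_type]
      refine Finset.sum_congr rfl fun l _ => ?_
      dsimp only
      set L := tensorOp fun p => (I p).kraus (o p) (l p)
      calc _ = Lᴴ * (∑ b, (tensorOp (K o b))ᴴ * tensorOp (K o b)) * L := by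
            simp only [tensorOp_mul, Matrix.mul_sum, Matrix.sum_mul, Matrix.conjTranspose_mul,
              Matrix.mul_assoc, L]
        _ = Lᴴ * L := by rw [h1, Matrix.mul_one]

/-- The squared Hilbert–Schmidt norm of a matrix. -/
noncomputable def hsSq {ι κ : Type*} [Fintype ι] [Fintype κ] (K : Matrix ι κ ℂ) : ℝ :=
  ∑ x, ∑ y, ‖K x y‖ ^ 2

theorem hsSq_nonneg {ι κ : Type*} [Fintype ι] [Fintype κ] (K : Matrix ι κ ℂ) : 0 ≤ hsSq K := by
  unfold hsSq
  positivity

theorem hsSq_eq_trace {ι κ : Type*} [Fintype ι] [Fintype κ] (K : Matrix ι κ ℂ) :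
    (Kᴴ * K).trace = (hsSq K : ℂ) := by
  simp only [hsSq, Matrix.trace, Matrix.diag, Matrix.mul_apply, Matrix.conjTranspose_apply,
    Complex.star_def, mul_comm, Complex.mul_conj, Complex.normSq_eq_norm_sq, Complex.ofReal_sum]
  exact Finset.sum_comm

theorem prod_hsSq [DecidableEq P] {d e : P → System} (K : ∀ p, Matrix (e p) (d p) ℂ) :
    ∏ p, hsSq (K p) = hsSq (tensorOp K) := by
  simp only [hsSq, tensorOp, Matrix.of_apply, norm_prod, Finset.prod_univ_sum,
    Fintype.piFinset_univ, Finset.prod_pow]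

/-- The weights of a complete family of product operators add up to the dimension. -/
theorem sum_prod_hsSq [DecidableEq P] {B : Type} [Fintype B] {d : P → System} {e : B → P → System}
    (K : ∀ b p, Matrix (e b p) (d p) ℂ) (h : ∑ b, (tensorOp (K b))ᴴ * tensorOp (K b) = 1) :
    ∑ b, ∏ p, hsSq (K b p) = Fintype.card (Joint d) := by
  have := congrArg (fun M => M.trace.re) h
  simpa only [Matrix.trace_sum, hsSq_eq_trace, Complex.re_sum, Complex.ofReal_re,
    Matrix.trace_one, Complex.natCast_re, ← prod_hsSq] using this

end

/-! ### Minors of `A T Bᵀ` -/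

/-- The `2 × 2` minors of a matrix with two columns are bounded by the arithmetic-geometric mean
inequality for the norms of these columns. -/
theorem sum_minor_two_columns_le {α : Type*} [Fintype α] (A : Matrix α (Fin 2) ℂ) :
    ∑ s, ∑ s', ‖A s 0 * A s' 1 - A s 1 * A s' 0‖ ^ 2 ≤ hsSq A ^ 2 / 2 := by
  set X := ∑ s, ‖A s 0‖ ^ 2 with hX
  set Y := ∑ s, ‖A s 1‖ ^ 2 with hY
  have hA : hsSq A = X + Y := by
    simp only [hsSq, Fin.sum_univ_two, Finset.sum_add_distrib, hX, hY]
  have h1 : ∑ s, ∑ s', ‖A s 0 * A s' 1‖ ^ 2 = X * Y := by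
    simp only [norm_mul, mul_pow, hX, hY, Finset.sum_mul_sum]
  have h2 : ∑ s, ∑ s', ‖A s 1 * A s' 0‖ ^ 2 = Y * X := by
    simp only [norm_mul, mul_pow, hX, hY, Finset.sum_mul_sum]
  have h3 : ∑ s, ∑ s', ((A s 0 * A s' 1) * star (A s 1 * A s' 0)).re =
      ‖∑ s, A s 0 * star (A s 1)‖ ^ 2 := by
    have : ((‖∑ s, A s 0 * star (A s 1)‖ ^ 2 : ℝ) : ℂ) =
        ∑ s, ∑ s', (A s 0 * A s' 1) * star (A s 1 * A s' 0) := by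
      rw [← Complex.normSq_eq_norm_sq, ← Complex.mul_conj, ← Complex.star_def, star_sum,
        Finset.sum_mul_sum]
      refine Finset.sum_congr rfl fun s _ => Finset.sum_congr rfl fun s' _ => ?_
      simp only [star_mul', star_star]
      ring
    have := congrArg Complex.re this
    simpa only [Complex.re_sum, Complex.ofReal_re] using this.symm
  simp only [norm_sub_sq_complex, Finset.sum_sub_distrib, Finset.sum_add_distrib, ← Finset.mul_sum]
  rw [h1, h2, h3, hA]
  nlinarith [sq_nonneg (X - Y), sq_nonneg ‖∑ s, A s 0 * star (A s 1)‖]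

theorem norm_det_le (M : Matrix (Fin 2) (Fin 2) ℂ) : ‖M.det‖ ≤ hsSq M / 2 := by
  rw [Matrix.det_fin_two]
  refine (norm_sub_le _ _).trans ?_
  simp only [norm_mul, hsSq, Fin.sum_univ_two]
  nlinarith [sq_nonneg (‖M 0 0‖ - ‖M 1 1‖), sq_nonneg (‖M 0 1‖ - ‖M 1 0‖)]

/-- By Cauchy–Binet the minors of `A T Bᵀ` are products of the minors of `A` and `B` with
`det T`. -/
theorem minorNorm_le_of_factor {α β : Type*} [Fintype α] [Fintype β] (A : Matrix α (Fin 2) ℂ)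
    (T : Matrix (Fin 2) (Fin 2) ℂ) (B : Matrix β (Fin 2) ℂ) :
    minorNorm (fun u : α × β => A u.1 ⬝ᵥ T *ᵥ B u.2) ≤ ‖T.det‖ * hsSq A * hsSq B / 2 := by
  unfold minorNorm
  apply Real.sqrt_le_iff.2
  have hA := hsSq_nonneg A
  have hB := hsSq_nonneg B
  refine ⟨by positivity, ?_⟩
  calc _ = ‖T.det‖ ^ 2 * ((∑ s, ∑ s', ‖A s 0 * A s' 1 - A s 1 * A s' 0‖ ^ 2) *
        ∑ t, ∑ t', ‖B t 0 * B t' 1 - B t 1 * B t' 0‖ ^ 2) := by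
        rw [Finset.sum_mul, Finset.mul_sum]
        refine Finset.sum_congr rfl fun s _ => ?_
        rw [Finset.sum_mul, Finset.mul_sum]
        refine Finset.sum_congr rfl fun s' _ => ?_
        rw [Finset.mul_sum, Finset.mul_sum]
        refine Finset.sum_congr rfl fun t _ => ?_
        rw [Finset.mul_sum, Finset.mul_sum]
        refine Finset.sum_congr rfl fun t' _ => ?_
        rw [← mul_pow, ← mul_pow, ← norm_mul, ← norm_mul]
        simp only [Matrix.det_fin_two, dotProduct, Matrix.mulVec, Fin.sum_univ_two]
        congr 2
        ring
    _ ≤ ‖T.det‖ ^ 2 * ((hsSq A ^ 2 / 2) * (hsSq B ^ 2 / 2)) := by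
        gcongr
        · exact sum_minor_two_columns_le A
        · exact sum_minor_two_columns_le B
    _ = _ := by ring

theorem minorNorm_two (v : Fin 2 × Fin 2 → ℂ) :
    minorNorm v = 2 * ‖(Matrix.of fun a b => v (a, b)).det‖ := by
  unfold minorNorm
  rw [Real.sqrt_eq_iff_mul_self_eq (by positivity) (by positivity)]
  simp only [Fin.sum_univ_two, Matrix.det_fin_two, Matrix.of_apply]
  rw [norm_sub_rev (v (0, 1) * v (1, 0)), norm_sub_rev (v (1, 0) * v (0, 1)),
    mul_comm (v (1, 1)), mul_comm (v (1, 0))]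
  simp only [sub_self, mul_comm, norm_zero]
  ring

/-! ### Contraction of a chain of matrices -/

/-- Contracting a chain `f - U 0 - B 0 - U 1 - ⋯ - B (n - 1) - U n - g` gives a bilinear form in the
end vectors `f` and `g`, whose matrix `U 0 * B 0 * ⋯ * U n` has the product of all determinants as
its determinant. -/
theorem exists_chain_contraction {m R : Type*} [Fintype m] [DecidableEq m] [CommRing R] (n : ℕ)
    (U : Fin (n + 1) → Matrix m m R) (B : Fin n → Matrix m m R) :
    ∃ T : Matrix m m R, T.det = (∏ k, (U k).det) * ∏ k, (B k).det ∧
      ∀ f g : m → R, ∑ l : Fin (n + 1) → m, ∑ r : Fin (n + 1) → m,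
        f (l 0) * g (r (Fin.last n)) * (∏ k, U k (l k) (r k)) *
          ∏ k : Fin n, B k (r k.castSucc) (l k.succ) = f ⬝ᵥ T *ᵥ g := by
  induction n with
  | zero =>
    refine ⟨U 0, by simp, fun f g => ?_⟩
    rw [← (Equiv.funUnique (Fin 1) m).symm.sum_comp]
    simp only [dotProduct, Matrix.mulVec, Finset.mul_sum]
    refine Finset.sum_congr rfl fun a _ => ?_
    rw [← (Equiv.funUnique (Fin 1) m).symm.sum_comp]
    refine Finset.sum_congr rfl fun b _ => ?_
    simp
    ring
  | succ n ih =>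
    obtain ⟨T, hdet, hT⟩ := ih (fun k => U k.succ) (fun k => B k.succ)
    refine ⟨U 0 * B 0 * T, ?_, fun f g => ?_⟩
    · rw [Matrix.det_mul, Matrix.det_mul, hdet, Fin.prod_univ_succ (fun k => (U k).det),
        Fin.prod_univ_succ (fun k => (B k).det)]
      ring
    · have h := hT (f ᵥ* (U 0 * B 0)) g
      rw [← Matrix.dotProduct_mulVec, Matrix.mulVec_mulVec] at h
      rw [← h, ← (Fin.consEquiv fun _ => m).sum_comp, Fintype.sum_prod_type_right]
      refine Finset.sum_congr rfl fun l _ => ?_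
      simp_rw [← (Fin.consEquiv fun _ : Fin (n + 2) => m).sum_comp fun r => _,
        Fintype.sum_prod_type_right]
      rw [Finset.sum_comm]
      refine Finset.sum_congr rfl fun r _ => ?_
      simp only [Fin.consEquiv, Equiv.coe_fn_mk, Fin.cons_zero, ← Fin.succ_last, Fin.cons_succ,
        Fin.prod_univ_succ (n := n + 1), Fin.prod_univ_succ (n := n), Fin.castSucc_zero,
        ← Fin.succ_castSucc,
        Matrix.vecMul, dotProduct, Matrix.mul_apply, Finset.sum_mul, Finset.mul_sum]
      refine Finset.sum_congr rfl fun a _ => Finset.sum_congr rfl fun b _ => ?_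
      ring

/-! ### Reduction to the two end parties -/

/-- A tuple on `Fin (n + 2)` consists of its first and last entry and of the inner ones. -/
def endsEquiv {n : ℕ} (e : Fin (n + 2) → Type) :
    (e 0 × e (Fin.last (n + 1))) × (∀ k : Fin n, e k.castSucc.succ) ≃ ∀ p, e p where
  toFun w := Fin.cons w.1.1 (Fin.snoc (α := fun i => e i.succ) w.2 w.1.2)
  invFun x := ((x 0, x (Fin.last (n + 1))), fun k => x k.castSucc.succ)
  left_inv w := by
    simp [← Fin.succ_last]
  right_inv x := by
    funext p
    refine Fin.cases rfl (fun i => ?_) p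
    refine Fin.lastCases ?_ (fun k => ?_) i
    · simp
    · simp

section

variable {n : ℕ} {e : Fin (n + 2) → Type}
  (w : (e 0 × e (Fin.last (n + 1))) × (∀ k : Fin n, e k.castSucc.succ))

@[simp] theorem endsEquiv_zero : endsEquiv e w 0 = w.1.1 := rfl

@[simp] theorem endsEquiv_last : endsEquiv e w (Fin.last (n + 1)) = w.1.2 := by
  simp [endsEquiv, ← Fin.succ_last]

@[simp] theorem endsEquiv_mid (k : Fin n) : endsEquiv e w k.castSucc.succ = w.2 k := by
  simp [endsEquiv]

end

theorem prod_ends_mid {n : ℕ} {M : Type*} [CommMonoid M] (f : Fin (n + 2) → M) :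
    ∏ p, f p = f 0 * f (Fin.last (n + 1)) * ∏ k : Fin n, f k.castSucc.succ := by
  rw [Fin.prod_univ_succ, Fin.prod_univ_castSucc, Fin.succ_last, mul_assoc,
    mul_comm (f (Fin.last _))]

theorem sum_ite_fst_eq {A Z M : Type*} [Fintype A] [Fintype Z] [AddCommMonoid M] (u v : A)
    (F : A × Z → A × Z → M)
    [dec : ∀ w w' : A × Z, Decidable (w.1 = u ∧ w' = (v, w.2))] :
    ∑ w, ∑ w', (if w.1 = u ∧ w' = (v, w.2) then F w w' else 0) = ∑ z, F (u, z) (v, z) := by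
  rw [Fintype.sum_prod_type_right]
  refine Finset.sum_congr rfl fun z _ => ?_
  rw [Finset.sum_eq_single u (fun a _ ha => by simp [ha]) (by simp),
    Finset.sum_eq_single (v, z) (fun w' _ hw => by simp [hw]) (by simp)]
  simp

theorem reduce_apply {n : ℕ} {e : Fin (n + 2) → System} (X : Op e)
    (u v : e 0 × e (Fin.last (n + 1))) :
    reduce 0 (Fin.last (n + 1)) X u v =
      ∑ z, X (endsEquiv (fun p => e p) (u, z)) (endsEquiv (fun p => e p) (v, z)) := by
  have key : ∀ w w' : (e 0 × e (Fin.last (n + 1))) × (∀ k : Fin n, e k.castSucc.succ),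
      (endsEquiv (fun p => e p) w 0 = u.1 ∧ endsEquiv (fun p => e p) w (Fin.last (n + 1)) = u.2 ∧
        endsEquiv (fun p => e p) w' 0 = v.1 ∧ endsEquiv (fun p => e p) w' (Fin.last (n + 1)) = v.2 ∧
        ∀ p, p ≠ 0 → p ≠ Fin.last (n + 1) →
          endsEquiv (fun p => e p) w p = endsEquiv (fun p => e p) w' p) ↔
      w.1 = u ∧ w' = (v, w.2) := by
    intro w w'
    simp only [endsEquiv_zero, endsEquiv_last, Prod.ext_iff]
    constructor
    · rintro ⟨h1, h2, h3, h4, h5⟩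
      refine ⟨⟨h1, h2⟩, ⟨h3, h4⟩, funext fun k => ?_⟩
      have := h5 k.castSucc.succ (Fin.succ_ne_zero _) (by
        rw [← Fin.succ_last, Ne, Fin.succ_inj]
        exact (Fin.castSucc_lt_last k).ne)
      simpa using this.symm
    · rintro ⟨⟨h1, h2⟩, ⟨h3, h4⟩, h5⟩
      refine ⟨h1, h2, h3, h4, fun p hp0 hpl => ?_⟩
      obtain ⟨i, rfl⟩ := Fin.exists_succ_eq.2 hp0
      rw [← Fin.succ_last, Ne, Fin.succ_inj] at hpl
      obtain ⟨k, rfl⟩ := Fin.exists_castSucc_eq.2 hpl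
      simp [h5]
  simp only [reduce, Matrix.of_apply]
  refine (((endsEquiv fun p => e p).sum_comp _).symm.trans (Finset.sum_congr rfl fun w _ =>
    ((endsEquiv fun p => e p).sum_comp _).symm)).trans ?_
  simp only [key]
  exact sum_ite_fst_eq (M := ℂ) u v fun w w' =>
    X (endsEquiv (fun p => e p) w) (endsEquiv (fun p => e p) w')

theorem trace_reduce {n : ℕ} {e : Fin (n + 2) → System} (X : Op e) :
    (reduce 0 (Fin.last (n + 1)) X).trace = X.trace := by
  simp only [Matrix.trace, Matrix.diag, reduce_apply]
  rw [← (endsEquiv fun p => (e p : Type)).sum_comp]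
  exact (Fintype.sum_prod_type fun w =>
    X (endsEquiv (fun p => e p) w) (endsEquiv (fun p => e p) w)).symm

theorem reduce_sum {n : ℕ} {e : Fin (n + 2) → System} {ι : Type*} (s : Finset ι) (X : ι → Op e) :
    reduce 0 (Fin.last (n + 1)) (∑ i ∈ s, X i) =
      ∑ i ∈ s, reduce 0 (Fin.last (n + 1)) (X i) := by
  ext u v
  simp only [reduce_apply, Matrix.sum_apply]
  exact Finset.sum_comm

theorem reduce_smul {n : ℕ} {e : Fin (n + 2) → System} (c : ℂ) (X : Op e) :
    reduce 0 (Fin.last (n + 1)) (c • X) = c • reduce 0 (Fin.last (n + 1)) X := by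
  ext u v
  simp only [reduce_apply, Matrix.smul_apply, Finset.smul_sum]

theorem reduce_ketbra {n : ℕ} {e : Fin (n + 2) → System} (Φ : Joint e → ℂ) :
    reduce 0 (Fin.last (n + 1)) (ketbra Φ) =
      ∑ z, ketbra fun u => Φ (endsEquiv (fun p => e p) (u, z)) := by
  ext u v
  simp only [reduce_apply, Matrix.sum_apply, ketbra, Matrix.vecMulVec_apply, Pi.star_apply]

/-! ### The chain of qubits -/

/-- A basis label of the joint system of the chain consists of the values of the left and of the
right qubits of all pairs. -/
def chainEquiv (N : ℕ) : (Fin N → Fin 2) × (Fin N → Fin 2) ≃ Joint (chainSystem N) where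
  toFun w := fun _ q => if q.1.2 = 0 then w.1 q.1.1 else w.2 q.1.1
  invFun x := (fun k => qubit x (k, 0), fun k => qubit x (k, 1))
  left_inv w := by simp [qubit]
  right_inv x := by
    funext p ⟨⟨k, c⟩, h⟩
    subst h
    rcases Fin.exists_fin_two.1 ⟨c, rfl⟩ with rfl | rfl <;> simp [qubit]

theorem card_joint_chainSystem (N : ℕ) : Fintype.card (Joint (chainSystem N)) = 4 ^ N := by
  rw [← Fintype.card_congr (chainEquiv N), Fintype.card_prod, Fintype.card_fun, Fintype.card_fin,
    Fintype.card_fin, ← mul_pow]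
  norm_num

/-- The basis label of an end party whose only qubit has the value `a`. -/
def endShare {N : ℕ} (p : Fin (N + 1)) (a : Fin 2) : chainSystem N p := fun _ => a

/-- The basis label of the inner party `k + 1` whose qubits, the right one of the pair `k` and the
left one of the pair `k + 1`, have the values `a` and `b`. -/
def midShare {n : ℕ} (k : Fin n) (w : Fin 2 × Fin 2) : chainSystem (n + 1) k.castSucc.succ :=
  fun q => if q.1.2 = 0 then w.2 else w.1

theorem chainEquiv_zero {n : ℕ} (l r : Fin (n + 1) → Fin 2) :
    chainEquiv (n + 1) (l, r) 0 = endShare 0 (l 0) := by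
  funext ⟨⟨k, c⟩, h⟩
  by_cases hc : c = 0
  · have : k = 0 := by simpa [owner, hc] using h
    exact (if_pos hc).trans (congrArg l this)
  · simp [owner, hc] at h

theorem chainEquiv_last {n : ℕ} (l r : Fin (n + 1) → Fin 2) :
    chainEquiv (n + 1) (l, r) (Fin.last (n + 1)) = endShare _ (r (Fin.last n)) := by
  funext ⟨⟨k, c⟩, h⟩
  by_cases hc : c = 0
  · simp only [owner, hc, if_true] at h
    exact absurd h (Fin.castSucc_lt_last k).ne
  · have : k = Fin.last n := by
      simp only [owner, hc, if_false] at h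
      rwa [← Fin.succ_last, Fin.succ_inj] at h
    exact (if_neg hc).trans (congrArg r this)

theorem chainEquiv_mid {n : ℕ} (l r : Fin (n + 1) → Fin 2) (k : Fin n) :
    chainEquiv (n + 1) (l, r) k.castSucc.succ = midShare k (r k.castSucc, l k.succ) := by
  funext ⟨⟨i, c⟩, h⟩
  by_cases hc : c = 0
  · have : i = k.succ := by
      simp only [owner, hc, if_true] at h
      rwa [Fin.succ_castSucc, Fin.castSucc_inj] at h
    exact ((if_pos hc).trans (congrArg l this)).trans (if_pos hc).symm
  · have : i = k.castSucc := by
      simp only [owner, hc, if_false] at h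
      rwa [Fin.succ_inj] at h
    exact ((if_neg hc).trans (congrArg r this)).trans (if_neg hc).symm

theorem endShare_zero_injective {n : ℕ} :
    Function.Injective (endShare (0 : Fin (n + 2))) := fun _ _ h =>
  congrFun h ⟨(0, 0), rfl⟩

theorem endShare_last_injective {n : ℕ} :
    Function.Injective (endShare (Fin.last (n + 1))) := fun _ _ h =>
  congrFun h ⟨(Fin.last n, 1), rfl⟩

theorem midShare_injective {n : ℕ} (k : Fin n) : Function.Injective (midShare k) := by
  intro w w' h
  have h1 := congrFun h ⟨(k.castSucc, 1), rfl⟩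
  have h0 := congrFun h ⟨(k.succ, 0), rfl⟩
  exact Prod.ext (by simpa [midShare] using h1) (by simpa [midShare] using h0)

/-- The unnormalized pure state of the chain, the tensor product of the vectors `u k`. -/
def chainVec {N : ℕ} (u : Fin N → Fin 2 × Fin 2 → ℂ) (x : Joint (chainSystem N)) : ℂ :=
  ∏ k, u k (qubit x (k, 0), qubit x (k, 1))

theorem chainState_sum_ketbra {N : ℕ} {ι : Fin N → Type} [∀ k, Fintype (ι k)]
    (u : ∀ k, ι k → Fin 2 × Fin 2 → ℂ) :
    chainState (fun k => ∑ i, ketbra (u k i)) =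
      ∑ i : ∀ k, ι k, ketbra (chainVec fun k => u k (i k)) := by
  ext x y
  simp only [chainState, Matrix.of_apply, Matrix.sum_apply, ketbra, Matrix.vecMulVec_apply,
    Pi.star_apply, chainVec, star_prod, Finset.prod_univ_sum, Fintype.piFinset_univ,
    Finset.prod_mul_distrib]

section

variable {n : ℕ} {e : Fin (n + 2) → System}
  (K : ∀ p, Matrix (e p) (chainSystem (n + 1) p) ℂ)

/-- The operator of an inner party with its output in the basis state `z`, as a matrix in the
values of the two qubits of this party. -/
def midMatrix (k : Fin n) (z : e k.castSucc.succ) : Matrix (Fin 2) (Fin 2) ℂ :=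
  Matrix.of fun a b => K k.castSucc.succ z (midShare k (a, b))

/-- The operator of an end party as a matrix in the value of its only qubit. -/
def endMatrix (p : Fin (n + 2)) : Matrix (e p) (Fin 2) ℂ :=
  (K p).submatrix id (endShare p)

theorem hsSq_submatrix_le {ι κ κ' : Type*} [Fintype ι] [Fintype κ] [Fintype κ']
    (M : Matrix ι κ ℂ) {f : κ' → κ} (hf : Function.Injective f) :
    hsSq (M.submatrix id f) ≤ hsSq M :=
  Finset.sum_le_sum fun x _ => by
    have := Finset.sum_map Finset.univ ⟨f, hf⟩ fun y => ‖M x y‖ ^ 2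
    exact this.symm.le.trans
      (Finset.sum_le_sum_of_subset_of_nonneg (Finset.subset_univ _) fun _ _ _ => by positivity)

theorem sum_hsSq_midMatrix_le (k : Fin n) :
    ∑ z, hsSq (midMatrix K k z) ≤ hsSq (K k.castSucc.succ) := by
  refine le_of_eq_of_le ?_ (hsSq_submatrix_le (K k.castSucc.succ) (midShare_injective k))
  simp only [hsSq, midMatrix, Matrix.of_apply, Matrix.submatrix_apply, id, Fintype.sum_prod_type]

/-- When the inner parties are projected to the basis state `z`, the vector of the end parties that
is left is of the form `A T Bᵀ`, where `A` and `B` are the operators of the end parties and `T` is a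
`2 × 2` matrix whose determinant is a product along the chain. -/
theorem exists_factor_slice (u : Fin (n + 1) → Fin 2 × Fin 2 → ℂ)
    (z : ∀ k : Fin n, e k.castSucc.succ) :
    ∃ T : Matrix (Fin 2) (Fin 2) ℂ,
      T.det = (∏ k, (Matrix.of fun a b => u k (a, b)).det) * ∏ k, (midMatrix K k (z k)).det ∧
      (fun w => (tensorOp K *ᵥ chainVec u) (endsEquiv (fun p => e p) (w, z))) =
        fun w => endMatrix K 0 w.1 ⬝ᵥ T *ᵥ endMatrix K (Fin.last (n + 1)) w.2 := by
  obtain ⟨T, hdet, hT⟩ := exists_chain_contraction n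
    (fun k => Matrix.of fun a b => u k (a, b)) (fun k => midMatrix K k (z k))
  refine ⟨T, hdet, funext fun w => ?_⟩
  rw [← hT, Matrix.mulVec, dotProduct, ← (chainEquiv (n + 1)).sum_comp, Fintype.sum_prod_type]
  refine Finset.sum_congr rfl fun l _ => Finset.sum_congr rfl fun r _ => ?_
  simp only [tensorOp, Matrix.of_apply, prod_ends_mid, chainEquiv_zero, chainEquiv_last,
    chainEquiv_mid, endsEquiv_zero, endsEquiv_last, endsEquiv_mid]
  have hq : chainVec u (chainEquiv (n + 1) (l, r)) = ∏ k, u k (l k, r k) := rfl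
  rw [hq]
  simp only [endMatrix, midMatrix, Matrix.submatrix_apply, Matrix.of_apply, id]
  ring

/-- The convex roof bound for one branch and a pure initial state. The dimension `4 ^ (n + 1)` is
the product of a factor `2` for each of the `n + 1` pairs, whose concurrence is `2 |det|`, a factor `2`
for each of the `n` inner parties, from `|det B| ≤ ‖B‖² / 2`, and a last factor `2` from the two end
parties. -/
theorem hasRoof_branch (u : Fin (n + 1) → Fin 2 × Fin 2 → ℂ) :
    HasRoof (reduce 0 (Fin.last (n + 1)) (ketbra (tensorOp K *ᵥ chainVec u)))
      ((∏ k, minorNorm (u k)) * ((4 ^ (n + 1))⁻¹ * ∏ p, hsSq (K p))) := by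
  rw [reduce_ketbra]
  refine (HasRoof.sum fun z => HasRoof.ketbra _).mono ?_
  choose T hdet hT using exists_factor_slice K u
  set D := ∏ k, ‖(Matrix.of fun a b => u k (a, b)).det‖ with hD
  have hD0 : 0 ≤ D := by positivity
  have hC : ∏ k, minorNorm (u k) = 2 ^ (n + 1) * D := by
    simp only [minorNorm_two, Finset.prod_mul_distrib, Finset.prod_const, Finset.card_univ,
      Fintype.card_fin, hD]
  have h0 : hsSq (endMatrix K 0) ≤ hsSq (K 0) :=
    hsSq_submatrix_le _ endShare_zero_injective
  have hl : hsSq (endMatrix K (Fin.last (n + 1))) ≤ hsSq (K (Fin.last (n + 1))) :=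
    hsSq_submatrix_le _ endShare_last_injective
  have hslice : ∀ z, minorNorm (fun w =>
      (tensorOp K *ᵥ chainVec u) (endsEquiv (fun p => e p) (w, z))) ≤
      (D * hsSq (K 0) * hsSq (K (Fin.last (n + 1))) / 2) *
        ∏ k, (hsSq (midMatrix K k (z k)) / 2) := by
    intro z
    rw [hT z]
    refine (minorNorm_le_of_factor _ _ _).trans ?_
    have hd : ‖(T z).det‖ ≤ D * ∏ k, (hsSq (midMatrix K k (z k)) / 2) := by
      rw [hdet, norm_mul, norm_prod, norm_prod]
      gcongr with k
      exact norm_det_le _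
    have := hsSq_nonneg (endMatrix K 0)
    have := hsSq_nonneg (endMatrix K (Fin.last (n + 1)))
    have := hsSq_nonneg (K 0)
    have : 0 ≤ ∏ k, (hsSq (midMatrix K k (z k)) / 2) :=
      Finset.prod_nonneg fun k _ => div_nonneg (hsSq_nonneg _) zero_le_two
    calc _ ≤ (D * ∏ k, (hsSq (midMatrix K k (z k)) / 2)) * hsSq (K 0) *
          hsSq (K (Fin.last (n + 1))) / 2 := by gcongr
      _ = _ := by ring
  refine (Finset.sum_le_sum fun z _ => hslice z).trans ?_
  rw [← Finset.mul_sum]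
  have hmid : ∑ z : ∀ k : Fin n, e k.castSucc.succ, ∏ k, (hsSq (midMatrix K k (z k)) / 2) ≤
      (∏ k : Fin n, hsSq (K k.castSucc.succ)) / 2 ^ n := by
    have := Finset.prod_univ_sum (fun k : Fin n => (Finset.univ : Finset (e k.castSucc.succ)))
      fun k z => hsSq (midMatrix K k z) / 2
    rw [Fintype.piFinset_univ] at this
    rw [← this]
    simp only [← Finset.sum_div, Finset.prod_div_distrib, Finset.prod_const, Finset.card_univ,
      Fintype.card_fin]
    gcongr with k
    · exact fun _ _ => Finset.sum_nonneg fun _ _ => hsSq_nonneg _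
    · exact sum_hsSq_midMatrix_le K k
  have h1 := hsSq_nonneg (K 0)
  have h2 := hsSq_nonneg (K (Fin.last (n + 1)))
  refine (mul_le_mul_of_nonneg_left hmid (by positivity)).trans (le_of_eq ?_)
  rw [hC, prod_ends_mid fun p => hsSq (K p),
    show (4 : ℝ) ^ (n + 1) = 2 ^ (n + 1) * 2 ^ (n + 1) by rw [← mul_pow]; norm_num]
  field_simp
  ring

end

/-! ### The bound for LOCC protocols -/

/-- The bound of the average final concurrence in terms of convex roof bounds of the two-qubit
states. -/
theorem sum_prob_mul_concurrence_le {n : ℕ}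
    {ρ : Fin (n + 1) → Matrix (Fin 2 × Fin 2) (Fin 2 × Fin 2) ℂ} {c : Fin (n + 1) → ℝ}
    (hρ : ∀ k, HasRoof (ρ k) (c k)) {J : Type} [Fintype J] [DecidableEq J]
    {out : J → Fin (n + 2) → System} (Λ : LOCC out (chainSystem (n + 1))) :
    ∑ j, Λ.prob (chainState ρ) j *
        concurrence (reduce 0 (Fin.last (n + 1)) (Λ.state (chainState ρ) j)) ≤ ∏ k, c k := by
  choose ι hι u hu hc using hρ
  obtain rfl : ρ = _ := funext hu
  obtain ⟨B, _, f, K, hK, h1⟩ := Λ.exists_branches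
  set ρ' := chainState fun k => ∑ i, ketbra (u k i) with hρ'
  set C := ∏ k, ∑ i, minorNorm (u k i) with hCdef
  let wt : B → ℝ := fun b => (4 ^ (n + 1))⁻¹ * ∏ p, hsSq (K b p)
  have hwt : ∑ b, wt b = 1 := by
    rw [← Finset.mul_sum, sum_prod_hsSq K h1, card_joint_chainSystem]
    push_cast
    exact inv_mul_cancel₀ (by positivity)
  have hbranch : ∀ b, HasRoof (reduce 0 (Fin.last (n + 1))
      (tensorOp (K b) * ρ' * (tensorOp (K b))ᴴ)) (C * wt b) := by
    intro b
    rw [hρ', chainState_sum_ketbra, Matrix.mul_sum, Matrix.sum_mul, reduce_sum, hCdef,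
      Finset.prod_univ_sum, Fintype.piFinset_univ, Finset.sum_mul]
    refine HasRoof.sum fun i => ?_
    rw [mul_ketbra_mul]
    exact hasRoof_branch (K b) _
  have hfinal : ∀ j, HasRoof (reduce 0 (Fin.last (n + 1)) (Λ.final ρ' j))
      (∑ b, if f b = j then C * wt b else 0) := by
    intro j
    rw [hK, Finset.sum_apply, reduce_sum]
    refine HasRoof.sum fun b => ?_
    by_cases hj : f b = j
    · subst hj
      rw [Pi.single_eq_same, if_pos rfl]
      exact hbranch b
    · rw [Pi.single_eq_of_ne' hj, if_neg hj]
      have h0 : reduce 0 (Fin.last (n + 1)) (0 : Op (out j)) = 0 := by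
        ext x y
        simp [reduce_apply]
      rw [h0]
      exact HasRoof.zero
  calc _ ≤ ∑ j, ∑ b, (if f b = j then C * wt b else 0) := by
        refine Finset.sum_le_sum fun j _ => ?_
        have := (hfinal j).mul_concurrence_le
        rwa [trace_reduce, ← reduce_smul] at this
    _ = C := by
        rw [Finset.sum_comm]
        simp only [Finset.sum_ite_eq, Finset.mem_univ, if_true]
        rw [← Finset.mul_sum, hwt, mul_one]
    _ ≤ ∏ k, c k :=
        Finset.prod_le_prod (fun k _ => Finset.sum_nonneg fun i _ => minorNorm_nonneg _)
          fun k _ => hc k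

end QNet

theorem corollary1 (N : ℕ) (hN : 1 ≤ N)
    (ρ : Fin N → Matrix (Fin 2 × Fin 2) (Fin 2 × Fin 2) ℂ)
    (hρ : ∀ k, QNet.IsDensity (ρ k))
    (J : Type) [Fintype J] [DecidableEq J]
    (out : J → Fin (N + 1) → QNet.System)
    (Λ : QNet.LOCC out (QNet.chainSystem N)) :
    ∑ j, Λ.prob (QNet.chainState ρ) j *
        QNet.concurrence (QNet.reduce 0 (Fin.last N) (Λ.state (QNet.chainState ρ) j))
      ≤ ∏ k, QNet.concurrence (ρ k) := by
  obtain ⟨n, rfl⟩ := Nat.exists_eq_add_of_le' hN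
  -- the infima need not be known to be attained: the bound holds up to `ε` in each factor
  have hcont : Filter.Tendsto (fun ε : ℝ => ∏ k, (QNet.concurrence (ρ k) + ε))
      (nhdsWithin 0 (Set.Ioi 0)) (nhds (∏ k, (QNet.concurrence (ρ k) + 0))) :=
    (Continuous.tendsto (by fun_prop) 0).mono_left nhdsWithin_le_nhds
  simp only [add_zero] at hcont
  refine ge_of_tendsto hcont ?_
  filter_upwards [self_mem_nhdsWithin] with ε hε
  exact QNet.sum_prob_mul_concurrence_le (fun k => (hρ k).exists_roof hε) Λ
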